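/- Let $G$ be a group and let $A, B, C\le G$ be subgroups such that $G = A *_C B$, i.e. $C\le A\cap B$ and the canonical homomorphism to $G$ from the free product of $A$ and $B$ with amalgamated subgroup $C$ is an isomorphism. Suppose that $C$ is infinite cyclic, $C\neq A$ and $C\neq B$, and that 1. $G$ has the unique root property: for all $x,y\in G$ and every positive integer $n$, $x^n=y^n$ implies $x=y$; 2. there is a surjective homomorphism $A/\langle\langle C\rangle\rangle_A\to\mathbb Z$, where $\langle\langle C\rangle\rangle_A$ is the normal closure of $C$ in $A$; 3. if $B$ is abelian, then there is a surjective homomorphism $B\to\mathbb Z$. Then the abstract commensurator $\mathrm{Comm}(G)$ is not finitely generated. Here $\mathrm{Comm}(G)$ is the group of equivalence classes $[\alpha]$ of isomorphisms $\alpha: H\to H'$ between subgroups of finite index of $G$, where two such isomorphisms are equivalent if they are both defined and agree on some subgroup of finite index of $G$; the product of the classes of $\alpha:G_1\to G_1'$ and $\beta:G_2\to G_2'$ is the class of the map $\alpha^{-1}(G_1'\cap G_2)\to\beta(G_1'\cap G_2)$ that applies first $\alpha$ and then $\beta$. -/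

import Mathlib

/-- A group has the unique root property if `x ^ n = y ^ n` with `n` a positive integer
implies `x = y`. -/
def HasUniqueRoots (G : Type*) [Group G] : Prop :=
  ∀ (x y : G) (n : ℕ), 0 < n → x ^ n = y ^ n → x = y

/-- A group maps homomorphically onto the infinite cyclic group. -/
def MapsOntoInt (G : Type*) [Group G] : Prop :=
  ∃ f : G →* Multiplicative ℤ, Function.Surjective f

/-- The two subgroups `A`, `B` as a family indexed by `Bool`. -/
def amalgamFactor {G : Type*} [Group G] (A B : Subgroup G) (i : Bool) : Subgroup G :=
  match i with
  | false => A
  | true => B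

theorem le_amalgamFactor {G : Type*} [Group G] {A B C : Subgroup G} (hA : C ≤ A) (hB : C ≤ B)
    (i : Bool) : C ≤ amalgamFactor A B i := by
  cases i
  · exact hA
  · exact hB

/-- The canonical homomorphism to `G` from the amalgamated free product (the pushout) of its
subgroups `A` and `B` over their common subgroup `C`. -/
def amalgamHom {G : Type*} [Group G] {A B C : Subgroup G} (hA : C ≤ A) (hB : C ≤ B) :
    Monoid.PushoutI (fun i : Bool => Subgroup.inclusion (le_amalgamFactor hA hB i)) →* G :=
  Monoid.PushoutI.lift (fun i => (amalgamFactor A B i).subtype) C.subtype (fun _ => rfl)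

/-- `G = A *_C B`: the group `G` is the free product of its subgroups `A` and `B` with the
common subgroup `C` amalgamated. -/
def IsAmalgamatedProduct {G : Type*} [Group G] (A B C : Subgroup G) : Prop :=
  ∃ (hA : C ≤ A) (hB : C ≤ B), Function.Bijective (amalgamHom hA hB)

/-- An isomorphism between two subgroups of finite index of `G`. -/
structure FiniteIndexIso (G : Type*) [Group G] where
  dom : Subgroup G
  cod : Subgroup G
  dom_finiteIndex : dom.FiniteIndex
  cod_finiteIndex : cod.FiniteIndex
  iso : dom ≃* cod

namespace FiniteIndexIso

variable {G : Type*} [Group G]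

/-- The preimage `α⁻¹(cod ∩ K)`, as a subgroup of `G`. -/
def pre (α : FiniteIndexIso G) (K : Subgroup G) : Subgroup G :=
  ((K.subgroupOf α.cod).comap α.iso.toMonoidHom).map α.dom.subtype

theorem mem_pre {α : FiniteIndexIso G} {K : Subgroup G} {x : G} :
    x ∈ α.pre K ↔ ∃ h : x ∈ α.dom, (α.iso ⟨x, h⟩ : G) ∈ K := by
  simp [pre, Subgroup.mem_subgroupOf]

theorem pre_finiteIndex (α : FiniteIndexIso G) {K : Subgroup G} (hK : K.FiniteIndex) :
    (α.pre K).FiniteIndex := by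
  have := α.dom_finiteIndex
  have h1 : (K.subgroupOf α.cod).FiniteIndex := inferInstance
  refine ⟨?_⟩
  rw [pre, Subgroup.index_map_subtype]
  refine mul_ne_zero ?_ this.index_ne_zero
  rw [Subgroup.index_comap_of_surjective _ α.iso.surjective]
  exact h1.index_ne_zero

/-- The inverse isomorphism. -/
def symm (α : FiniteIndexIso G) : FiniteIndexIso G where
  dom := α.cod
  cod := α.dom
  dom_finiteIndex := α.cod_finiteIndex
  cod_finiteIndex := α.dom_finiteIndex
  iso := α.iso.symm

/-- The identity of `G`. -/
def refl (G : Type*) [Group G] : FiniteIndexIso G where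
  dom := ⊤
  cod := ⊤
  dom_finiteIndex := inferInstance
  cod_finiteIndex := inferInstance
  iso := MulEquiv.refl _

/-- The product of `α : G₁ → G₁'` and `β : G₂ → G₂'`, namely "first `α`, then `β`" as an
isomorphism `α⁻¹(G₁' ∩ G₂) → β(G₁' ∩ G₂)`. -/
def comp (α β : FiniteIndexIso G) : FiniteIndexIso G where
  dom := α.pre β.dom
  cod := β.symm.pre α.cod
  dom_finiteIndex := α.pre_finiteIndex β.dom_finiteIndex
  cod_finiteIndex := β.symm.pre_finiteIndex α.cod_finiteIndex
  iso :=
    { toFun := fun x => ⟨β.iso ⟨α.iso ⟨x, (mem_pre.1 x.2).1⟩, (mem_pre.1 x.2).2⟩,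
        mem_pre.2 ⟨(β.iso _).2, (congrArg (fun z : β.dom => (z : G) ∈ α.cod)
          (β.iso.symm_apply_apply _)).mpr (α.iso _).2⟩⟩
      invFun := fun y => ⟨α.iso.symm ⟨β.iso.symm ⟨y, (mem_pre.1 y.2).1⟩, (mem_pre.1 y.2).2⟩,
        mem_pre.2 ⟨(α.iso.symm _).2, (congrArg (fun z : α.cod => (z : G) ∈ β.dom)
          (α.iso.apply_symm_apply _)).mpr (β.iso.symm _).2⟩⟩
      left_inv := fun x => Subtype.ext <| by
        have e (z : β.dom) (h) (h') : α.iso.symm ⟨(β.iso.symm ⟨(β.iso z : G), h⟩ : G), h'⟩ =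
            α.iso.symm ⟨z, by simpa using h'⟩ := by simp
        exact (congrArg Subtype.val (e _ _ _)).trans
          (congrArg Subtype.val (α.iso.symm_apply_apply ⟨x, (mem_pre.1 x.2).1⟩))
      right_inv := fun y => Subtype.ext <| by
        have e (z : α.cod) (h) (h') : β.iso ⟨(α.iso ⟨(α.iso.symm z : G), h⟩ : G), h'⟩ =
            β.iso ⟨z, by simpa using h'⟩ := by simp
        exact (congrArg Subtype.val (e _ _ _)).trans
          (congrArg Subtype.val (β.iso.apply_symm_apply ⟨y, (mem_pre.1 y.2).1⟩))
      map_mul' := fun x y => by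
        apply Subtype.ext
        change (β.iso _ : G) = β.iso _ * β.iso _
        rw [← Subgroup.coe_mul, ← map_mul]
        congr 2
        apply Subtype.ext
        change (α.iso _ : G) = α.iso _ * α.iso _
        rw [← Subgroup.coe_mul, ← map_mul]
        rfl }

theorem comp_apply (α β : FiniteIndexIso G) {x : G} (hx : x ∈ (α.comp β).dom) :
    ((α.comp β).iso ⟨x, hx⟩ : G) =
      β.iso ⟨α.iso ⟨x, (mem_pre.1 hx).1⟩, (mem_pre.1 hx).2⟩ := rfl

/-- Two isomorphisms are equivalent if both are defined, and agree, on some subgroup of finite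
index of `G`. -/
def Equivalent (α β : FiniteIndexIso G) : Prop :=
  ∃ H : Subgroup G, H.FiniteIndex ∧ ∃ (hα : H ≤ α.dom) (hβ : H ≤ β.dom),
    ∀ (x : G) (hx : x ∈ H), (α.iso ⟨x, hα hx⟩ : G) = β.iso ⟨x, hβ hx⟩

theorem Equivalent.refl (α : FiniteIndexIso G) : Equivalent α α :=
  ⟨α.dom, α.dom_finiteIndex, le_rfl, le_rfl, fun _ _ => rfl⟩

theorem Equivalent.symm {α β : FiniteIndexIso G} : Equivalent α β → Equivalent β α
  | ⟨H, hH, h1, h2, h⟩ => ⟨H, hH, h2, h1, fun x hx => (h x hx).symm⟩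

theorem Equivalent.trans {α β γ : FiniteIndexIso G} :
    Equivalent α β → Equivalent β γ → Equivalent α γ
  | ⟨H, _, h1, _, h⟩, ⟨K, _, _, k2, k⟩ =>
    ⟨H ⊓ K, inferInstance, inf_le_left.trans h1, inf_le_right.trans k2,
      fun x hx => (h x hx.1).trans (k x hx.2)⟩

/-- The equivalence relation whose classes are the elements of the abstract commensurator. -/
instance setoid (G : Type*) [Group G] : Setoid (FiniteIndexIso G) where
  r := Equivalent
  iseqv := ⟨Equivalent.refl, Equivalent.symm, Equivalent.trans⟩

theorem Equivalent.comp {α α' β β' : FiniteIndexIso G} :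
    Equivalent α α' → Equivalent β β' → Equivalent (α.comp β) (α'.comp β')
  | ⟨H, _, h1, h2, h⟩, ⟨K, hK, k1, k2, k⟩ => by
    have := α.pre_finiteIndex hK
    refine ⟨H ⊓ α.pre K, inferInstance, ?_, ?_, ?_⟩
    · rintro x ⟨_, hx⟩
      obtain ⟨hd, hx⟩ := mem_pre.1 hx
      exact mem_pre.2 ⟨hd, k1 hx⟩
    · rintro x ⟨hxH, hx⟩
      obtain ⟨hd, hx⟩ := mem_pre.1 hx
      refine mem_pre.2 ⟨h2 hxH, ?_⟩
      rw [← h x hxH]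
      exact k2 hx
    · rintro x ⟨hxH, hx⟩
      obtain ⟨hd, hx⟩ := mem_pre.1 hx
      rw [comp_apply, comp_apply, k _ hx]
      congr 2
      exact Subtype.ext (h x hxH)

theorem Equivalent.inv {α β : FiniteIndexIso G} :
    Equivalent α β → Equivalent α.symm β.symm
  | ⟨H, hH, h1, h2, h⟩ => by
    have key : ∀ y, y ∈ α.symm.pre H → ∃ x, ∃ hx : x ∈ H,
        (α.iso ⟨x, h1 hx⟩ : G) = y ∧ (β.iso ⟨x, h2 hx⟩ : G) = y := by
      intro y hy
      obtain ⟨hd, hy⟩ := mem_pre.1 hy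
      have e : (α.iso ⟨_, h1 hy⟩ : G) = y :=
        congrArg Subtype.val (α.iso.apply_symm_apply ⟨y, hd⟩)
      exact ⟨_, hy, e, (h _ hy).symm.trans e⟩
    refine ⟨α.symm.pre H, α.symm.pre_finiteIndex hH, ?_, ?_, ?_⟩
    · intro y hy
      exact (mem_pre.1 hy).1
    · intro y hy
      obtain ⟨x, hx, _, rfl⟩ := key y hy
      exact (β.iso _).2
    · intro y hy
      obtain ⟨x, hx, e1, e2⟩ := key y hy
      have f1 : α.iso.symm ⟨y, (mem_pre.1 hy).1⟩ = ⟨x, h1 hx⟩ := by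
        rw [MulEquiv.symm_apply_eq]
        exact Subtype.ext e1.symm
      have f2 : ∀ hy', β.iso.symm ⟨y, hy'⟩ = ⟨x, h2 hx⟩ := by
        intro hy'
        rw [MulEquiv.symm_apply_eq]
        exact Subtype.ext e2.symm
      exact (congrArg Subtype.val f1).trans (congrArg Subtype.val (f2 _)).symm

end FiniteIndexIso

/-- The abstract commensurator `Comm(G)`: isomorphisms between subgroups of finite index of `G`,
two of them being identified when they agree on a subgroup of finite index. -/
def AbstractCommensurator (G : Type*) [Group G] : Type _ :=
  Quotient (FiniteIndexIso.setoid G)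

namespace AbstractCommensurator

open FiniteIndexIso

/-- The group structure of `Comm(G)`, given by `[α][β] = [αβ]`. -/
instance group (G : Type*) [Group G] : Group (AbstractCommensurator G) where
  mul := Quotient.map₂ FiniteIndexIso.comp (fun _ _ h _ _ k => Equivalent.comp h k)
  one := Quotient.mk _ (FiniteIndexIso.refl G)
  inv := Quotient.map FiniteIndexIso.symm (fun _ _ h => Equivalent.inv h)
  mul_assoc := by
    rintro ⟨α⟩ ⟨β⟩ ⟨γ⟩
    refine Quotient.sound ⟨((α.comp β).comp γ).dom, ((α.comp β).comp γ).dom_finiteIndex,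
      le_rfl, ?_, fun _ _ => rfl⟩
    intro x hx
    obtain ⟨hx, h3⟩ := mem_pre.1 hx
    obtain ⟨h1, h2⟩ := mem_pre.1 hx
    exact mem_pre.2 ⟨h1, mem_pre.2 ⟨h2, h3⟩⟩
  one_mul := by
    rintro ⟨α⟩
    exact Quotient.sound ⟨α.dom, α.dom_finiteIndex,
      fun x hx => mem_pre.2 ⟨Subgroup.mem_top x, hx⟩, le_rfl, fun _ _ => rfl⟩
  mul_one := by
    rintro ⟨α⟩
    exact Quotient.sound ⟨α.dom, α.dom_finiteIndex,
      fun x hx => mem_pre.2 ⟨hx, Subgroup.mem_top _⟩, le_rfl, fun _ _ => rfl⟩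
  inv_mul_cancel := by
    rintro ⟨α⟩
    refine Quotient.sound ⟨α.cod, α.cod_finiteIndex,
      fun x hx => mem_pre.2 ⟨hx, (α.iso.symm _).2⟩, le_top, fun x hx => ?_⟩
    exact congrArg Subtype.val (α.iso.apply_symm_apply ⟨x, hx⟩)

end AbstractCommensurator

-- Suppose `Comm(G)` is generated by finitely many classes, and let `p` be a prime larger than all
-- the indices occurring in chosen representatives. Composition then represents every class by an
-- isomorphism whose domain contains, for each `t`, some `t ^ m` with `m` prime to `p`. A twist
-- contradicts this: a representative `α` fixes `t ^ m` because it fixes its `p`-th power and roots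
-- are unique. Since it also fixes `t ^ m * b ^ n * (t ^ m)⁻¹`, it fixes `b ^ n`, hence the twist
-- would fix `b` (`not_fg_of_hasTwist`).
--
-- To build twists, reduce the map `A → ℤ` modulo `p` to get `q : G → ℤ/p` killing `B`. Its kernel
-- is assembled from `A ∩ ker q` and the conjugates of `B` by `1, a, ..., a ^ (p - 1)`, where `a`
-- maps to `1`. An automorphism `τ ≠ 1` of `B` fixing the generator `c` of `C` can be applied to the
-- conjugate by `1` alone (`exists_twist`, `hasTwist`).
--
-- Such a `τ` is inner if `B` is not abelian. If `B` is abelian with `g : B → ℤ` onto, it is a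
-- transvection when `g c = 0` and inversion of `ker g` when `g c = ±1`. If `k = |g c| ≥ 2`, the
-- kernel of `G → ℤ/k` killing `A` is again an amalgam of `A` over `⟨c⟩`. Its second factor contains
-- nontrivial conjugates of `A`, and twisting one of them gives the automorphism
-- (`hasTwist_of_dvd`).

universe u

/-! ### A criterion for `Comm(G)` not to be finitely generated -/

/-- A commensuration `j ∘ i⁻¹` of `G` that fixes `t ^ p` and the conjugates `t ^ m * b ^ n * t ^ (-m)`
of the powers of some `b`, for all `m` prime to `p`, but does not fix `b` itself. -/
def HasTwist (G : Type u) [Group G] (p : ℕ) : Prop :=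
  ∃ (H : Type u) (_ : Group H) (i j : H →* G) (t : G) (b z : H),
    Function.Injective i ∧ Function.Injective j ∧ i.range.FiniteIndex ∧ j.range.FiniteIndex ∧
    i z = t ^ p ∧ j z = t ^ p ∧ j b ≠ i b ∧
    ∀ m n : ℕ, m.Coprime p → ∃ y, i y = t ^ m * i b ^ n * (t ^ m)⁻¹ ∧
      j y = t ^ m * i b ^ n * (t ^ m)⁻¹

/-- A twist of a subgroup of finite index is a twist of the whole group. -/
theorem HasTwist.of_injective {G K : Type u} [Group G] [Group K] (k : K →* G)
    (hk : Function.Injective k) (hfin : k.range.FiniteIndex) {p : ℕ} (h : HasTwist K p) :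
    HasTwist G p := by
  obtain ⟨H, _, i, j, t, b, z, hi, hj, hi', hj', hz, hz', hb, hy⟩ := h
  have fin (f : H →* K) (hf : f.range.FiniteIndex) : (k.comp f).range.FiniteIndex := by
    refine ⟨?_⟩
    rw [MonoidHom.range_comp, Subgroup.index_map, (MonoidHom.ker_eq_bot_iff k).2 hk, sup_bot_eq]
    exact mul_ne_zero hf.index_ne_zero hfin.index_ne_zero
  refine ⟨H, _, k.comp i, k.comp j, k t, b, z, hk.comp hi, hk.comp hj, fin i hi', fin j hj',
    ?_, ?_, ?_, ?_⟩
  · simp [hz]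
  · simp [hz']
  · simpa using fun e => hb (hk e)
  · intro m n hm
    obtain ⟨y, h1, h2⟩ := hy m n hm
    exact ⟨y, by simp [h1], by simp [h2]⟩

namespace FiniteIndexIso

variable {G : Type*} [Group G]

/-- Every element has a power with exponent prime to `p` in the subgroup. -/
def HasPowersPrimeTo (p : ℕ) (K : Subgroup G) : Prop :=
  ∀ t : G, ∃ m : ℕ, m.Coprime p ∧ t ^ m ∈ K

/-- The exponents for `α.dom` and `K` multiply. This closure under composition is why exponents are
tracked rather than indices. -/
theorem HasPowersPrimeTo.pre {p : ℕ} {α : FiniteIndexIso G} {K : Subgroup G}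
    (hα : HasPowersPrimeTo p α.dom) (hK : HasPowersPrimeTo p K) :
    HasPowersPrimeTo p (α.pre K) := by
  intro t
  obtain ⟨m, hm, h1⟩ := hα t
  obtain ⟨n, hn, h2⟩ := hK (α.iso ⟨t ^ m, h1⟩ : G)
  refine ⟨m * n, Nat.Coprime.mul_left hm hn, mem_pre.2 ⟨?_, ?_⟩⟩
  · rw [pow_mul]
    exact pow_mem h1 n
  · have e : (⟨t ^ (m * n), by rw [pow_mul]; exact pow_mem h1 n⟩ : α.dom) = ⟨t ^ m, h1⟩ ^ n :=
      Subtype.ext (pow_mul t m n)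
    rw [e, map_pow]
    exact h2

theorem hasPowersPrimeTo_of_index_lt {p : ℕ} (hp : p.Prime) {K : Subgroup G}
    (hK : K.FiniteIndex) (h : K.index < p) : HasPowersPrimeTo p K := by
  intro t
  obtain ⟨m, h1, h2, h3⟩ :=
    Subgroup.exists_pow_mem_of_index_ne_zero hK.index_ne_zero t
  exact ⟨m, (Nat.coprime_of_lt_prime h1.ne' (h2.trans_lt h) hp).symm, h3⟩

/-- In a group with unique roots, equivalent isomorphisms agree wherever both are defined. -/
theorem Equivalent.apply_eq (hroot : HasUniqueRoots G) {α β : FiniteIndexIso G}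
    (h : Equivalent α β) {x : G} (hα : x ∈ α.dom) (hβ : x ∈ β.dom) :
    (α.iso ⟨x, hα⟩ : G) = β.iso ⟨x, hβ⟩ := by
  obtain ⟨H, hH, h1, h2, h⟩ := h
  obtain ⟨n, hn, -, hx⟩ := Subgroup.exists_pow_mem_of_index_ne_zero hH.index_ne_zero x
  refine hroot _ _ n hn ?_
  have := h _ hx
  rwa [← Subgroup.coe_pow, ← Subgroup.coe_pow, ← map_pow, ← map_pow]

end FiniteIndexIso

namespace AbstractCommensurator

open FiniteIndexIso

theorem exists_hasPowersPrimeTo {G : Type*} [Group G] {p : ℕ} {S : Set (AbstractCommensurator G)}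
    (hS : ∀ s ∈ S, ∃ α : FiniteIndexIso G, (Quotient.mk _ α : AbstractCommensurator G) = s ∧
      HasPowersPrimeTo p α.dom ∧ HasPowersPrimeTo p α.cod)
    {w : AbstractCommensurator G} (hw : w ∈ Subgroup.closure S) :
    ∃ α : FiniteIndexIso G, (Quotient.mk _ α : AbstractCommensurator G) = w ∧
      HasPowersPrimeTo p α.dom ∧ HasPowersPrimeTo p α.cod := by
  induction hw using Subgroup.closure_induction with
  | mem s hs => exact hS s hs
  | one =>
    have h : HasPowersPrimeTo p (⊤ : Subgroup G) :=
      fun t => ⟨1, Nat.coprime_one_left p, Subgroup.mem_top _⟩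
    exact ⟨FiniteIndexIso.refl G, rfl, h, h⟩
  | mul x y _ _ hx hy =>
    obtain ⟨α, rfl, h1, h2⟩ := hx
    obtain ⟨β, rfl, h3, h4⟩ := hy
    exact ⟨α.comp β, rfl, h1.pre h3, HasPowersPrimeTo.pre (α := β.symm) h4 h2⟩
  | inv x _ hx =>
    obtain ⟨α, rfl, h1, h2⟩ := hx
    exact ⟨α.symm, rfl, h2, h1⟩

/-- A group with unique roots that has twists at all primes has a commensurator that is not
finitely generated. -/
theorem not_fg_of_hasTwist {G : Type u} [Group G] (hroot : HasUniqueRoots G)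
    (h : ∀ p : ℕ, p.Prime → HasTwist G p) : ¬ Group.FG (AbstractCommensurator G) := by
  intro hfg
  obtain ⟨S, hS, hfin⟩ := Group.fg_iff.1 hfg
  obtain ⟨N, hN⟩ : ∃ N : ℕ, ∀ s ∈ S, s.out.dom.index + s.out.cod.index ≤ N := by
    obtain ⟨N, hN⟩ := (hfin.image fun s => s.out.dom.index + s.out.cod.index).bddAbove
    exact ⟨N, fun s hs => hN ⟨s, hs, rfl⟩⟩
  obtain ⟨p, hNp, hp⟩ := Nat.exists_infinite_primes (N + 1)
  obtain ⟨H, _, i, j, t, b, z, hi, hj, hi', hj', hz, hz', hb, hy⟩ := h p hp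
  let φ : FiniteIndexIso G := ⟨i.range, j.range, hi', hj',
    (MonoidHom.ofInjective hi).symm.trans (MonoidHom.ofInjective hj)⟩
  have hφ (y : H) {x : G} (hx : x ∈ φ.dom) (e : i y = x) : (φ.iso ⟨x, hx⟩ : G) = j y := by
    subst e
    have : (⟨i y, hx⟩ : i.range) = MonoidHom.ofInjective hi y := rfl
    change (((MonoidHom.ofInjective hj) ((MonoidHom.ofInjective hi).symm ⟨i y, hx⟩) : j.range) : G)
      = _
    rw [this, MulEquiv.symm_apply_apply]
    rfl
  obtain ⟨α, hα, hdom, -⟩ := exists_hasPowersPrimeTo (p := p) (S := S) (fun s hs => by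
      have := hN s hs
      exact ⟨s.out, s.out_eq,
        hasPowersPrimeTo_of_index_lt hp s.out.dom_finiteIndex (by omega),
        hasPowersPrimeTo_of_index_lt hp s.out.cod_finiteIndex (by omega)⟩)
    (w := (Quotient.mk _ φ : AbstractCommensurator G)) (hS ▸ Subgroup.mem_top _)
  have key {x : G} (hx : x ∈ α.dom) (y : H) (e : i y = x) : (α.iso ⟨x, hx⟩ : G) = j y := by
    rw [Equivalent.apply_eq hroot (Quotient.exact hα) hx ⟨y, e⟩]
    exact hφ y _ e
  obtain ⟨m, hm, ht⟩ := hdom t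
  obtain ⟨n, hn, hbn⟩ : ∃ n : ℕ, 0 < n ∧ i b ^ n ∈ α.dom := by
    obtain ⟨n, hn, -, h⟩ :=
      Subgroup.exists_pow_mem_of_index_ne_zero α.dom_finiteIndex.index_ne_zero (i b)
    exact ⟨n, hn, h⟩
  -- Both sides have `p`-th power `(t ^ p) ^ m`, which the twist fixes.
  have e1 : (α.iso ⟨t ^ m, ht⟩ : G) = t ^ m := by
    refine hroot _ _ p hp.pos ?_
    rw [← Subgroup.coe_pow, ← map_pow, ← pow_mul, mul_comm, pow_mul, ← hz', ← map_pow]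
    refine key _ _ ?_
    rw [map_pow, hz, ← pow_mul, mul_comm, pow_mul]
  obtain ⟨y, h1, h2⟩ := hy m n hm
  have e2 := key (mul_mem (mul_mem ht hbn) (inv_mem ht)) y h1
  have e3 : (⟨t ^ m * i b ^ n * (t ^ m)⁻¹, mul_mem (mul_mem ht hbn) (inv_mem ht)⟩ : α.dom) =
      ⟨t ^ m, ht⟩ * ⟨i b ^ n, hbn⟩ * ⟨t ^ m, ht⟩⁻¹ := rfl
  rw [e3, map_mul, map_mul, map_inv, Subgroup.coe_mul, Subgroup.coe_mul, Subgroup.coe_inv, e1,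
    key hbn (b ^ n) (map_pow i b n), h2, mul_left_inj, mul_right_inj, map_pow] at e2
  exact hb (hroot _ _ n hn e2)

end AbstractCommensurator

/-! ### Amalgamated products over a cyclic subgroup, through their universal property -/

/-- `G` is generated by the images of `A` and `B`, and homomorphisms on `A` and `B` that agree on
`cA ∈ A` and `cB ∈ B` extend to `G`. -/
structure IsCyclicAmalgam {A B G : Type u} [Group A] [Group B] [Group G] (iA : A →* G)
    (iB : B →* G) (cA : A) (cB : B) : Prop where
  comm : iA cA = iB cB
  generates : iA.range ⊔ iB.range = ⊤
  exists_lift : ∀ (Y : Type u) [Group Y] (α : A →* Y) (β : B →* Y), α cA = β cB →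
    ∃ γ : G →* Y, (∀ a, γ (iA a) = α a) ∧ ∀ b, γ (iB b) = β b

namespace IsCyclicAmalgam

variable {A B G : Type u} [Group A] [Group B] [Group G] {iA : A →* G} {iB : B →* G} {cA : A}
  {cB : B}

theorem symm (h : IsCyclicAmalgam iA iB cA cB) : IsCyclicAmalgam iB iA cB cA where
  comm := h.comm.symm
  generates := by rw [sup_comm]; exact h.generates
  exists_lift Y _ α β e := by
    obtain ⟨γ, h1, h2⟩ := h.exists_lift Y β α e.symm
    exact ⟨γ, h2, h1⟩

theorem hom_ext (h : IsCyclicAmalgam iA iB cA cB) {Y : Type*} [Group Y] {γ γ' : G →* Y}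
    (hA : ∀ a, γ (iA a) = γ' (iA a)) (hB : ∀ b, γ (iB b) = γ' (iB b)) : γ = γ' := by
  have : iA.range ⊔ iB.range ≤ γ.eqLocus γ' := by
    refine sup_le ?_ ?_
    · rintro _ ⟨a, rfl⟩
      exact hA a
    · rintro _ ⟨b, rfl⟩
      exact hB b
  rw [h.generates] at this
  exact MonoidHom.ext fun g => this (Subgroup.mem_top g)

section Kernel

variable {Q : Type} [Group Q] {q : G →* Q}

/-- The kernel of a homomorphism that kills `B` is generated by its intersection with `A` and the
conjugates of `B` by elements of `A`. -/
theorem ker_le (h : IsCyclicAmalgam iA iB cA cB) (hq : ∀ b, q (iB b) = 1) {L : Subgroup G}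
    (hA : ∀ a, q (iA a) = 1 → iA a ∈ L) (hB : ∀ t b, iA t * iB b * (iA t)⁻¹ ∈ L) :
    q.ker ≤ L := by
  -- `M` is normalized by `A` and contains `B`, so every element of `G` lies in `M` times `A`.
  let M : Subgroup G :=
    { carrier := {x | q x = 1 ∧ ∀ t, iA t * x * (iA t)⁻¹ ∈ L}
      one_mem' := ⟨map_one q, fun t => by simp⟩
      mul_mem' := fun {x y} hx hy => ⟨by rw [map_mul, hx.1, hy.1, mul_one], fun t => by
        have := mul_mem (hx.2 t) (hy.2 t)
        simpa [mul_assoc] using this⟩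
      inv_mem' := fun {x} hx => ⟨by rw [map_inv, hx.1, inv_one], fun t => by
        have := inv_mem (hx.2 t)
        simpa [mul_assoc] using this⟩ }
  have hMA (a : A) (ha : q (iA a) = 1) : iA a ∈ M := ⟨ha, fun t => by
    have : q (iA (t * a * t⁻¹)) = 1 := by simp [ha]
    simpa using hA _ this⟩
  have hMB (b : B) : iB b ∈ M := ⟨hq b, fun t => hB t b⟩
  have hconj (t : A) (x : G) (hx : x ∈ M) : iA t * x * (iA t)⁻¹ ∈ M :=
    ⟨by simp [hx.1], fun r => by
      have := hx.2 (r * t)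
      simpa [mul_assoc] using this⟩
  have key (g : G) : ∃ a, g * iA a ∈ M := by
    have hg : g ∈ Subgroup.closure ((iA.range : Set G) ∪ iB.range) := by
      rw [← Subgroup.sup_eq_closure, h.generates]
      exact Subgroup.mem_top g
    induction hg using Subgroup.closure_induction with
    | mem g hg =>
      rcases hg with ⟨a, rfl⟩ | ⟨b, rfl⟩
      · exact ⟨a⁻¹, by simp⟩
      · exact ⟨1, by simpa using hMB b⟩
    | one => exact ⟨1, by simp⟩
    | mul x y _ _ hx hy =>
      obtain ⟨a, ha⟩ := hx
      obtain ⟨b, hb⟩ := hy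
      refine ⟨b * a, ?_⟩
      have := mul_mem ha (hconj a⁻¹ _ hb)
      simpa [mul_assoc] using this
    | inv x _ hx =>
      obtain ⟨a, ha⟩ := hx
      refine ⟨a⁻¹, ?_⟩
      have := hconj a _ (inv_mem ha)
      simpa [mul_assoc] using this
  have hML : M ≤ L := fun x hx => by simpa using hx.2 1
  intro g hg
  obtain ⟨a, ha⟩ := key g
  have hga : q (iA a) = 1 := by
    have := ha.1
    rwa [map_mul, MonoidHom.mem_ker.1 hg, one_mul] at this
  simpa using mul_mem (hML ha) (inv_mem (hA a hga))

theorem ker_hom_ext (h : IsCyclicAmalgam iA iB cA cB) (hq : ∀ b, q (iB b) = 1) {Y : Type*}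
    [Group Y] {γ γ' : q.ker →* Y} (hA : ∀ a ha, γ ⟨iA a, ha⟩ = γ' ⟨iA a, ha⟩)
    (hB : ∀ t b hb, γ ⟨iA t * iB b * (iA t)⁻¹, hb⟩ = γ' ⟨iA t * iB b * (iA t)⁻¹, hb⟩) :
    γ = γ' := by
  have : q.ker ≤ (γ.eqLocus γ').map q.ker.subtype :=
    h.ker_le hq (fun a ha => ⟨⟨iA a, ha⟩, hA a ha, rfl⟩)
      fun t b => ⟨⟨_, by simp [MonoidHom.mem_ker, hq]⟩, hB t b _, rfl⟩
  refine MonoidHom.ext fun x => ?_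
  obtain ⟨y, hy, e⟩ := this x.2
  rw [Subtype.ext e] at hy
  exact hy

/-- Homomorphisms on the kernel of a homomorphism that kills `B`: they may be prescribed on its
intersection with `A` and on the conjugates of `B` by the elements of a transversal. -/
theorem exists_ker_hom (h : IsCyclicAmalgam iA iB cA cB) (hq : ∀ b, q (iB b) = 1) (s : Q → A)
    (hs : ∀ x, q (iA (s x)) = x) (hs1 : s 1 = 1) {Y : Type u} [Group Y]
    (α : (q.comp iA).ker →* Y) (β : Q → B →* Y)
    (hαβ : ∀ x hx, α ⟨(s x)⁻¹ * cA * s x, hx⟩ = β x cB) :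
    ∃ γ : q.ker →* Y, (∀ a ha, γ ⟨iA a, ha⟩ = α ⟨a, ha⟩) ∧
      ∀ t b hb ht, γ ⟨iA t * iB b * (iA t)⁻¹, hb⟩ =
        α ⟨t * s (q (iA t))⁻¹, ht⟩ * β (q (iA t))⁻¹ b * (α ⟨t * s (q (iA t))⁻¹, ht⟩)⁻¹ := by
  have hmem (a : A) (x : Q) : (s x)⁻¹ * a * s ((q (iA a))⁻¹ * x) ∈ (q.comp iA).ker := by
    simp [MonoidHom.mem_ker, hs, mul_assoc]
  -- The Kaloujnine–Krasner embedding for the transversal `s`, followed by `α`. Working in the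
  -- wreath product replaces a presentation of the kernel by the universal property of `G`.
  let ΦA : A →* Y ≀ᵣ Q :=
    { toFun := fun a => ⟨fun x => α ⟨_, hmem a x⟩, q (iA a)⟩
      map_one' := by
        refine RegularWreathProduct.ext (funext fun x => ?_) (by simp)
        rw [RegularWreathProduct.one_left, Pi.one_apply, ← map_one α]
        refine congrArg α (Subtype.ext ?_)
        change (s x)⁻¹ * 1 * s ((q (iA 1))⁻¹ * x) = 1
        simp
      map_mul' := fun a b => by
        refine RegularWreathProduct.ext (funext fun x => ?_) (by simp)
        rw [RegularWreathProduct.mul_left, Pi.mul_apply]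
        change α _ = α _ * α _
        rw [← map_mul]
        congr 1
        exact Subtype.ext (by simp [mul_assoc]) }
  let ΦB : B →* Y ≀ᵣ Q :=
    { toFun := fun b => ⟨fun x => β x b, 1⟩
      map_one' := RegularWreathProduct.ext (funext fun x => by simp) rfl
      map_mul' := fun a b => RegularWreathProduct.ext (funext fun x => by simp) (by simp) }
  have hcA : q (iA cA) = 1 := by rw [h.comm, hq]
  obtain ⟨Γ, hΓA, hΓB⟩ := h.exists_lift (Y ≀ᵣ Q) ΦA ΦB <| by
    refine RegularWreathProduct.ext (funext fun x => ?_) hcA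
    change α _ = β x cB
    rw [← hαβ x (by simp [MonoidHom.mem_ker, hcA])]
    congr 1
    exact Subtype.ext (by simp [hcA])
  have hright (g : G) : (Γ g).right = q g :=
    DFunLike.congr_fun (h.hom_ext (γ := RegularWreathProduct.rightHom.comp Γ) (γ' := q)
      (fun a => congrArg RegularWreathProduct.right (hΓA a))
      (fun b => (congrArg RegularWreathProduct.right (hΓB b)).trans (hq b).symm)) g
  -- Elements of `ker q` do not permute the coordinates, so the coordinate at `1` is multiplicative
  -- on them.
  refine ⟨{ toFun := fun k => (Γ k).left 1, map_one' := by simp, map_mul' := fun k l => ?_ },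
    fun a ha => ?_, fun t b hb ht => ?_⟩
  · simp only [Subgroup.coe_mul, map_mul, RegularWreathProduct.mul_left, Pi.mul_apply, hright,
      MonoidHom.mem_ker.1 k.2, inv_one, one_mul]
  · change (Γ (iA a)).left 1 = _
    rw [hΓA]
    change α _ = α _
    congr 1
    have ha' : q (iA a) = 1 := ha
    exact Subtype.ext (by simp [ha', hs1])
  · have e : (Γ (iA t)).left 1 = α ⟨t * s (q (iA t))⁻¹, ht⟩ := by
      rw [hΓA]
      change α _ = α _
      congr 1
      exact Subtype.ext (by simp [hs1])
    change (Γ (iA t * iB b * (iA t)⁻¹)).left 1 = _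
    rw [eq_mul_inv_iff_mul_eq, ← e]
    have h1 : (Γ (iA t * iB b * (iA t)⁻¹)).left 1 * (Γ (iA t)).left 1 =
        (Γ (iA t * iB b * (iA t)⁻¹ * iA t)).left 1 := by
      rw [map_mul Γ _ (iA t), RegularWreathProduct.mul_left, Pi.mul_apply, hright,
        MonoidHom.mem_ker.1 hb, inv_one, one_mul]
    rw [h1, inv_mul_cancel_right, map_mul, RegularWreathProduct.mul_left, Pi.mul_apply, hright,
      hΓB, mul_one]
    rfl

/-- Twisting the conjugates of `B` in the kernel of a homomorphism that kills `B`. -/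
theorem exists_twist (h : IsCyclicAmalgam iA iB cA cB) (hq : ∀ b, q (iB b) = 1) (s : Q → A)
    (hs : ∀ x, q (iA (s x)) = x) (hs1 : s 1 = 1) (τ : Q → MulAut B) (hτ : ∀ x, τ x cB = cB) :
    ∃ φ : q.ker ≃* q.ker, (∀ a ha, φ ⟨iA a, ha⟩ = ⟨iA a, ha⟩) ∧
      ∀ t b hb, (φ ⟨iA t * iB b * (iA t)⁻¹, hb⟩ : G) =
        iA t * iB (τ (q (iA t)) b) * (iA t)⁻¹ := by
  -- Stated for every `τ`, so that the family of inverses supplies the inverse map.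
  have key (τ : Q → MulAut B) (hτ : ∀ x, τ x cB = cB) :
      ∃ φ : q.ker →* q.ker, (∀ a ha, φ ⟨iA a, ha⟩ = ⟨iA a, ha⟩) ∧
        ∀ t b hb, (φ ⟨iA t * iB b * (iA t)⁻¹, hb⟩ : G) =
          iA t * iB (τ (q (iA t)) b) * (iA t)⁻¹ := by
    let α : (q.comp iA).ker →* q.ker :=
      (iA.comp (q.comp iA).ker.subtype).codRestrict q.ker fun x => x.2
    let β (x : Q) : B →* q.ker :=
      ((MulAut.conj (iA (s x))⁻¹).toMonoidHom.comp (iB.comp (τ x⁻¹).toMonoidHom)).codRestrict q.ker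
        fun b => by simp [MonoidHom.mem_ker, hq]
    obtain ⟨φ, h1, h2⟩ := h.exists_ker_hom hq s hs hs1 α β <| by
      intro x hx
      apply Subtype.ext
      change iA ((s x)⁻¹ * cA * s x) = (iA (s x))⁻¹ * iB (τ x⁻¹ cB) * (iA (s x))⁻¹⁻¹
      rw [hτ, ← h.comm]
      simp
    refine ⟨φ, h1, fun t b hb => ?_⟩
    rw [h2 t b hb (by simp [MonoidHom.mem_ker, hs])]
    change iA (t * s (q (iA t))⁻¹) * ((iA (s (q (iA t))⁻¹))⁻¹ * iB (τ (q (iA t))⁻¹⁻¹ b) *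
      (iA (s (q (iA t))⁻¹))⁻¹⁻¹) * (iA (t * s (q (iA t))⁻¹))⁻¹ = _
    simp [mul_assoc]
  have inv (φ ψ : q.ker →* q.ker) (τ : Q → MulAut B)
      (h1 : ∀ a ha, φ ⟨iA a, ha⟩ = ⟨iA a, ha⟩)
      (h2 : ∀ t b hb, (φ ⟨iA t * iB b * (iA t)⁻¹, hb⟩ : G) =
        iA t * iB (τ (q (iA t)) b) * (iA t)⁻¹)
      (h3 : ∀ a ha, ψ ⟨iA a, ha⟩ = ⟨iA a, ha⟩)
      (h4 : ∀ t b hb, (ψ ⟨iA t * iB b * (iA t)⁻¹, hb⟩ : G) =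
        iA t * iB ((τ (q (iA t)))⁻¹ b) * (iA t)⁻¹) : ψ.comp φ = MonoidHom.id _ := by
    refine h.ker_hom_ext hq (fun a ha => ?_) fun t b hb => ?_
    · rw [MonoidHom.comp_apply, h1, h3, MonoidHom.id_apply]
    · have e : φ ⟨iA t * iB b * (iA t)⁻¹, hb⟩ = ⟨iA t * iB (τ (q (iA t)) b) * (iA t)⁻¹,
          by simp [MonoidHom.mem_ker, hq]⟩ := Subtype.ext (h2 t b hb)
      apply Subtype.ext
      rw [MonoidHom.comp_apply, e, h4, MonoidHom.id_apply, MulAut.inv_apply_self]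
  obtain ⟨φ, h1, h2⟩ := key τ hτ
  obtain ⟨ψ, h3, h4⟩ := key (fun x => (τ x)⁻¹) fun x => by
    rw [MulAut.inv_apply, MulEquiv.symm_apply_eq, hτ]
  exact ⟨φ.toMulEquiv ψ (inv φ ψ τ h1 h2 h3 h4)
    (inv ψ φ (fun x => (τ x)⁻¹) h3 h4 h1 (by simpa using h2)), h1, h2⟩

end Kernel

end IsCyclicAmalgam

/-! ### Automorphisms fixing an element -/

/-- If `c` is central, any noncentral element conjugates nontrivially and fixes `c`; otherwise
conjugation by `c` itself works. -/
theorem exists_mulAut_of_not_comm {B : Type*} [Group B] (c : B)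
    (hB : ¬ ∀ x y : B, x * y = y * x) : ∃ τ : MulAut B, τ c = c ∧ ∃ b, τ b ≠ b := by
  push Not at hB
  obtain ⟨x, y, hxy⟩ := hB
  have conj (z w : B) : MulAut.conj z w = w ↔ z * w = w * z := by
    rw [MulAut.conj_apply, mul_inv_eq_iff_eq_mul]
  by_cases hc : ∀ b, c * b = b * c
  · exact ⟨MulAut.conj x, (conj x c).2 (hc x).symm, y, fun e => hxy ((conj x y).1 e)⟩
  · push Not at hc
    obtain ⟨b, hb⟩ := hc
    exact ⟨MulAut.conj c, (conj c c).2 rfl, b, fun e => hb ((conj c b).1 e)⟩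

/-- In the abelian case, use the transvection `b ↦ b * c ^ f b`. -/
theorem exists_mulAut_of_map_eq_one {B : Type*} [Group B] {c : B} (hc : c ≠ 1)
    {f : B →* Multiplicative ℤ} (hf : Function.Surjective f) (hfc : f c = 1) :
    ∃ τ : MulAut B, τ c = c ∧ ∃ b, τ b ≠ b := by
  by_cases hB : ∀ x y : B, x * y = y * x
  · let _ : CommGroup B := { (inferInstance : Group B) with mul_comm := hB }
    have hz (n : ℤ) : f (c ^ n) = 1 := by rw [map_zpow, hfc, one_zpow]
    let τ : MulAut B :=
      { toFun := fun b => b * c ^ (f b).toAdd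
        invFun := fun b => b * c ^ (-(f b).toAdd)
        left_inv := fun b => by simp [hz, mul_assoc]
        right_inv := fun b => by simp [hfc, mul_assoc]
        map_mul' := fun a b => by
          rw [map_mul, toAdd_mul, zpow_add, mul_mul_mul_comm] }
    have hτ (b : B) : τ b = b * c ^ (f b).toAdd := rfl
    obtain ⟨b, hb⟩ := hf (Multiplicative.ofAdd 1)
    exact ⟨τ, by simp [hτ, hfc], b, by simpa [hτ, hb] using hc⟩
  · exact exists_mulAut_of_not_comm c hB

/-- Here `B` is the product of `⟨c⟩` and `ker f`; the involution fixes `c` and inverts `ker f`. An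
element it fixes has the same square as a power of `c`, hence is that power. -/
theorem exists_mulAut_of_isUnit {B : Type*} [Group B] (hB : ∀ x y : B, x * y = y * x)
    (hroot : HasUniqueRoots B) {c : B} (hc : ∃ b, b ∉ Subgroup.zpowers c)
    {f : B →* Multiplicative ℤ} (hfc : (f c).toAdd * (f c).toAdd = 1) :
    ∃ τ : MulAut B, τ c = c ∧ ∃ b, τ b ≠ b := by
  let _ : CommGroup B := { (inferInstance : Group B) with mul_comm := hB }
  set e := (f c).toAdd with he
  let r : B →* B :=
    { toFun := fun b => b⁻¹ * c ^ (2 * (e * (f b).toAdd))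
      map_one' := by simp
      map_mul' := fun a b => by
        rw [map_mul, toAdd_mul, mul_add, mul_add, zpow_add, mul_inv, mul_mul_mul_comm] }
  have hr (b : B) : r b = b⁻¹ * c ^ (2 * (e * (f b).toAdd)) := rfl
  have hfr (b : B) : (f (r b)).toAdd = (f b).toAdd := by
    rw [hr, map_mul, map_inv, map_zpow, toAdd_mul, toAdd_inv, toAdd_zpow, ← he, smul_eq_mul]
    linear_combination 2 * (f b).toAdd * hfc
  have hrr (b : B) : r (r b) = b := by
    rw [hr (r b), hfr, hr b]
    simp
  let τ : MulAut B :=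
    { toFun := r, invFun := r, left_inv := hrr, right_inv := hrr, map_mul' := map_mul r }
  obtain ⟨b, hb⟩ := hc
  refine ⟨τ, ?_, b, fun h => hb ?_⟩
  · change r c = c
    rw [hr, ← he, hfc, mul_one, zpow_ofNat, pow_two, inv_mul_cancel_left]
  · have h : b⁻¹ * c ^ (2 * (e * (f b).toAdd)) = b := h
    refine ⟨e * (f b).toAdd, hroot _ _ 2 two_pos ?_⟩
    rw [inv_mul_eq_iff_eq_mul] at h
    rw [pow_two b, ← h]
    change (c ^ (e * (f b).toAdd)) ^ 2 = _
    rw [← zpow_natCast, ← zpow_mul, mul_comm 2]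
    rfl

/-! ### Twists of amalgamated products -/

namespace IsCyclicAmalgam

variable {A B G : Type u} [Group A] [Group B] [Group G] {iA : A →* G} {iB : B →* G} {cA : A}
  {cB : B}

/-- A homomorphism of `A` onto the integers that maps `cA` into `n ℤ` induces a homomorphism of `G`
onto the integers modulo `n` that kills `B`. -/
theorem exists_hom_zmod (h : IsCyclicAmalgam iA iB cA cB) (n : ℕ) [NeZero n]
    (f : A →* Multiplicative ℤ) (hf : ((f cA).toAdd : ZMod n) = 0) {a : A}
    (ha : f a = Multiplicative.ofAdd 1) :
    ∃ (q : G →* Multiplicative (ZMod n)) (s : Multiplicative (ZMod n) → A),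
      (∀ b, q (iB b) = 1) ∧ (∀ m : ℕ, q (iA (a ^ m)) = Multiplicative.ofAdd (m : ZMod n)) ∧
      (∀ x, q (iA (s x)) = x) ∧ s 1 = 1 := by
  let F : A →* Multiplicative (ZMod n) :=
    (AddMonoidHom.toMultiplicative (Int.castAddHom (ZMod n))).comp f
  have hF (x : A) : F x = Multiplicative.ofAdd ((f x).toAdd : ZMod n) := rfl
  -- `ULift` only moves the target into the universe of `exists_lift`.
  obtain ⟨γ, h1, h2⟩ := h.exists_lift (ULift.{u} (Multiplicative (ZMod n)))
    (MulEquiv.ulift.symm.toMonoidHom.comp F) 1 <| by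
      change MulEquiv.ulift.symm (F cA) = 1
      rw [hF, hf, ofAdd_zero, map_one]
  have hm (m : ℕ) : MulEquiv.ulift (γ (iA (a ^ m))) = Multiplicative.ofAdd (m : ZMod n) := by
    rw [h1]
    change F (a ^ m) = _
    rw [hF, map_pow, ha]
    simp
  refine ⟨MulEquiv.ulift.toMonoidHom.comp γ, fun x => a ^ (x.toAdd).val, fun b => ?_, hm,
    fun x => ?_, ?_⟩
  · change MulEquiv.ulift (γ (iB b)) = 1
    rw [h2, MonoidHom.one_apply, map_one]
  · refine (hm _).trans ?_
    rw [ZMod.natCast_zmod_val, ofAdd_toAdd]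
  · simp

theorem hasTwist (h : IsCyclicAmalgam iA iB cA cB) (hiB : Function.Injective iB)
    {f : A →* Multiplicative ℤ} (hf : Function.Surjective f) (hfc : f cA = 1)
    (hτ : ∃ τ : MulAut B, τ cB = cB ∧ ∃ b, τ b ≠ b) {p : ℕ} (hp : p.Prime) : HasTwist G p := by
  have : Fact p.Prime := ⟨hp⟩
  obtain ⟨τ, hτc, b, hb⟩ := hτ
  obtain ⟨a, ha⟩ := hf (Multiplicative.ofAdd 1)
  obtain ⟨q, s, hqB, hqA, hs, hs1⟩ := h.exists_hom_zmod p f (by simp [hfc]) ha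
  -- Only `B` itself is twisted; its conjugates by `a ^ m` with `m` prime to `p` lie over nontrivial
  -- classes and stay fixed.
  obtain ⟨φ, h1, h2⟩ := h.exists_twist hqB s hs hs1 (fun x => if x = 1 then τ else 1)
    (fun x => by split_ifs <;> simp [hτc])
  have hrange : (q.ker.subtype.comp φ.toMonoidHom).range = q.ker := by
    rw [MonoidHom.range_comp, MonoidHom.range_eq_top.2 φ.surjective, ← MonoidHom.range_eq_map,
      Subgroup.range_subtype]
  have hmem (t : A) (b : B) : iA t * iB b * (iA t)⁻¹ ∈ q.ker := by
    simp [MonoidHom.mem_ker, hqB]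
  have hap : iA (a ^ p) ∈ q.ker := by
    rw [MonoidHom.mem_ker, hqA, ZMod.natCast_self, ofAdd_zero]
  have hφ (t : A) (b : B) := h2 t b (hmem t b)
  refine ⟨q.ker, inferInstance, q.ker.subtype, q.ker.subtype.comp φ.toMonoidHom, iA a,
    ⟨iA 1 * iB b * (iA 1)⁻¹, hmem 1 b⟩, ⟨iA (a ^ p), hap⟩, Subtype.val_injective,
    Subtype.val_injective.comp φ.injective, ?_, ?_, map_pow iA a p, ?_, ?_, fun m n hm => ?_⟩
  · rw [Subgroup.range_subtype]
    infer_instance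
  · rw [hrange]
    infer_instance
  · change ((φ ⟨iA (a ^ p), hap⟩ : q.ker) : G) = _
    rw [h1]
    exact map_pow iA a p
  · change ((φ ⟨iA 1 * iB b * (iA 1)⁻¹, hmem 1 b⟩ : q.ker) : G) ≠ iA 1 * iB b * (iA 1)⁻¹
    rw [hφ]
    simpa using fun e => hb (hiB e)
  · refine ⟨⟨iA (a ^ m) * iB (b ^ n) * (iA (a ^ m))⁻¹, hmem _ _⟩, by simp, ?_⟩
    change ((φ ⟨iA (a ^ m) * iB (b ^ n) * (iA (a ^ m))⁻¹, hmem _ _⟩ : q.ker) : G) = _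
    have hne : q (iA (a ^ m)) ≠ 1 := by
      rw [hqA]
      intro e
      have e : (m : ZMod p) = 0 := e
      rw [ZMod.natCast_eq_zero_iff] at e
      exact hp.one_lt.ne' (Nat.dvd_one.1 (hm ▸ Nat.dvd_gcd e dvd_rfl))
    rw [hφ, if_neg hne]
    simp

end IsCyclicAmalgam

/-! ### Passing to a subgroup of finite index when `B` is abelian -/

namespace IsCyclicAmalgam

variable {A B G : Type u} [Group A] [Group B] [Group G] {iA : A →* G} {iB : B →* G} {cA : A}
  {cB : B}

section Kernel

variable {Q : Type} [Group Q] {q : G →* Q}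

/-- The subgroup of `ker q` generated by the elements of `B` and the conjugates of `A` by the
elements of `B` outside `ker q`. -/
def complement (iA : A →* G) (iB : B →* G) (q : G →* Q) : Subgroup q.ker :=
  Subgroup.closure ({x | ∃ b, (x : G) = iB b} ∪
    {x | ∃ t a, q (iB t) ≠ 1 ∧ (x : G) = iB t * iA a * (iB t)⁻¹})

theorem mem_complement {x : q.ker} {b : B} (h : (x : G) = iB b) : x ∈ complement iA iB q :=
  Subgroup.subset_closure (Or.inl ⟨b, h⟩)

theorem conj_mem_complement {x : q.ker} {t : B} {a : A} (ht : q (iB t) ≠ 1)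
    (h : (x : G) = iB t * iA a * (iB t)⁻¹) : x ∈ complement iA iB q :=
  Subgroup.subset_closure (Or.inr ⟨t, a, ht, h⟩)

theorem coe_mem_ker (h : IsCyclicAmalgam iA iB cA cB) (hq : ∀ a, q (iA a) = 1) :
    iB cB ∈ q.ker := by
  rw [MonoidHom.mem_ker, ← h.comm, hq]

/-- If `B` is abelian, then the kernel of a homomorphism that kills `A` is the amalgamated product
of `A` and the subgroup generated by the elements of `B` and the nontrivial conjugates of `A`. -/
theorem ker_isCyclicAmalgam (h : IsCyclicAmalgam iA iB cA cB) (hB : ∀ x y : B, x * y = y * x)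
    (hq : ∀ a, q (iA a) = 1) (s : Q → B) (hs : ∀ x, q (iB (s x)) = x) (hs1 : s 1 = 1) :
    IsCyclicAmalgam (iA.codRestrict q.ker hq) (complement iA iB q).subtype cA
      ⟨⟨iB cB, h.coe_mem_ker hq⟩, mem_complement rfl⟩ where
  comm := Subtype.ext h.comm
  generates := by
    have hmem (b : B) (hb : q (iB b) = 1) : (⟨iB b, hb⟩ : q.ker) ∈
        (iA.codRestrict q.ker hq).range ⊔ (complement iA iB q).subtype.range := by
      rw [Subgroup.range_subtype]
      exact Subgroup.mem_sup_right (mem_complement rfl)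
    have : q.ker ≤
        ((iA.codRestrict q.ker hq).range ⊔ (complement iA iB q).subtype.range).map
          q.ker.subtype := by
      refine h.symm.ker_le hq (fun b hb => ⟨⟨iB b, hb⟩, hmem b hb, rfl⟩) fun t a => ?_
      by_cases ht : q (iB t) = 1
      · exact ⟨⟨iB t, ht⟩ * iA.codRestrict q.ker hq a * ⟨iB t, ht⟩⁻¹,
          mul_mem (mul_mem (hmem t ht) (Subgroup.mem_sup_left ⟨a, rfl⟩)) (inv_mem (hmem t ht)), rfl⟩
      · refine ⟨⟨iB t * iA a * (iB t)⁻¹, by simp [MonoidHom.mem_ker, hq]⟩, ?_, rfl⟩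
        rw [Subgroup.range_subtype]
        exact Subgroup.mem_sup_right (conj_mem_complement ht rfl)
    refine top_le_iff.1 fun x _ => ?_
    obtain ⟨y, hy, e⟩ := this x.2
    rwa [Subtype.ext e] at hy
  exists_lift Y _ α β hαβ := by
    let ψ₀ : (q.comp iB).ker →* complement iA iB q :=
      ((iB.comp (q.comp iB).ker.subtype).codRestrict q.ker fun x => x.2).codRestrict
        (complement iA iB q) fun x => mem_complement rfl
    let ψ (x : Q) (hx : x ≠ 1) : A →* complement iA iB q :=
      (((MulAut.conj (iB (s x)⁻¹)).toMonoidHom.comp iA).codRestrict q.ker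
        fun a => by simp [MonoidHom.mem_ker, hq]).codRestrict
          (complement iA iB q) fun a => conj_mem_complement (t := (s x)⁻¹) (by simpa [hs]) rfl
    have hψ (x : Q) (hx : x ≠ 1) (a : A) : (((ψ x hx a : complement iA iB q) : q.ker) : G) =
      iB (s x)⁻¹ * iA a * (iB (s x)⁻¹)⁻¹ := rfl
    classical
    -- `A` itself is mapped by `α`, its other conjugates through the complement by `β`.
    let β' (x : Q) : A →* Y := if hx : x = 1 then α else β.comp (ψ x hx)
    have hβ' (x : Q) (hx : x = 1) (a : A) : β' x a = α a := by simp only [β', dif_pos hx]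
    have hβ'' (x : Q) (hx : x ≠ 1) (a : A) : β' x a = β (ψ x hx a) := by
      simp only [β', dif_neg hx, MonoidHom.comp_apply]
    obtain ⟨γ, h1, h2⟩ := h.symm.exists_ker_hom hq s hs hs1 (β.comp ψ₀) β' <| by
      intro x hx
      -- As `B` is abelian, all the conjugates of `A` are glued along the same element, so one
      -- compatibility condition suffices.
      have hcomm : (s x)⁻¹ * cB * s x = cB := by rw [hB _ cB, inv_mul_cancel_right]
      rw [MonoidHom.comp_apply]
      by_cases hx1 : x = 1
      · rw [hβ' x hx1, hαβ]
        exact congrArg β (Subtype.ext (Subtype.ext (congrArg iB hcomm)))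
      · rw [hβ'' x hx1]
        refine congrArg β (Subtype.ext (Subtype.ext ?_))
        rw [hψ x hx1, h.comm]
        change iB ((s x)⁻¹ * cB * s x) = _
        simp
    have hγA (a : A) : γ (iA.codRestrict q.ker hq a) = α a := by
      have e1 : iA.codRestrict q.ker hq a =
          ⟨iB 1 * iA a * (iB 1)⁻¹, by simp [MonoidHom.mem_ker, hq]⟩ := Subtype.ext <| by
            change iA a = _
            simp
      have e2 (ht) : (⟨1 * s (q (iB 1))⁻¹, ht⟩ : (q.comp iB).ker) = 1 :=
        Subtype.ext (by simp [hs1])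
      rw [e1, h2 1 a _ (by simp [MonoidHom.mem_ker, hs]), e2, hβ' _ (by simp)]
      simp
    refine ⟨γ, hγA, ?_⟩
    rintro ⟨m, hm⟩
    change γ m = _
    induction hm using Subgroup.closure_induction with
    | mem x hx =>
      rcases hx with ⟨b, hb⟩ | ⟨t, a, ht, hb⟩
      · have hb' : q (iB b) = 1 := hb ▸ x.2
        have e : x = ⟨iB b, hb'⟩ := Subtype.ext hb
        refine (congrArg γ e).trans ((h1 b hb').trans ?_)
        exact congrArg β (Subtype.ext (Subtype.ext hb.symm))
      · have e : x = ⟨iB t * iA a * (iB t)⁻¹, by simp [MonoidHom.mem_ker, hq]⟩ := Subtype.ext hb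
        have ht' : (q (iB t))⁻¹ ≠ 1 := inv_ne_one.2 ht
        refine (congrArg γ e).trans ((h2 t a _ (by simp [MonoidHom.mem_ker, hs])).trans ?_)
        rw [hβ'' _ ht', MonoidHom.comp_apply, ← map_inv β, ← map_mul, ← map_mul]
        refine congrArg β (Subtype.ext (Subtype.ext ?_))
        rw [hb]
        change iB (t * s (q (iB t))⁻¹) * (iB (s (q (iB t))⁻¹)⁻¹ * iA a *
          (iB (s (q (iB t))⁻¹)⁻¹)⁻¹) * (iB (t * s (q (iB t))⁻¹))⁻¹ = _
        simp [mul_assoc]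
    | one => exact (map_one γ).trans (map_one β).symm
    | mul x y hx hy ihx ihy =>
      rw [map_mul, ihx, ihy, ← map_mul]
      rfl
    | inv x hx ihx =>
      rw [map_inv, ihx, ← map_inv]
      rfl

/-- A nontrivial automorphism of `A` that fixes `cA` induces a nontrivial automorphism of the
subgroup generated by the elements of `B` and the nontrivial conjugates of `A`. -/
theorem exists_mulAut_complement (h : IsCyclicAmalgam iA iB cA cB) (hiA : Function.Injective iA)
    (hq : ∀ a, q (iA a) = 1) (s : Q → B) (hs : ∀ x, q (iB (s x)) = x) (hs1 : s 1 = 1)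
    (hQ : ∃ x : Q, x ≠ 1) (hτ : ∃ τ : MulAut A, τ cA = cA ∧ ∃ a, τ a ≠ a) :
    ∃ τ : MulAut (complement iA iB q),
      τ ⟨⟨iB cB, h.coe_mem_ker hq⟩, mem_complement rfl⟩ =
        ⟨⟨iB cB, h.coe_mem_ker hq⟩, mem_complement rfl⟩ ∧ ∃ b, τ b ≠ b := by
  classical
  obtain ⟨τ, hτc, a, ha⟩ := hτ
  obtain ⟨x, hx⟩ := hQ
  -- Twist only the conjugates of `A` over one class `x ≠ 1`; these lie in the complement.
  obtain ⟨φ, h1, h2⟩ := h.symm.exists_twist hq s hs hs1 (fun y => if y = x then τ else 1)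
    (fun y => by split_ifs <;> simp [hτc])
  have hmem (t : B) (a : A) : iB t * iA a * (iB t)⁻¹ ∈ q.ker := by
    simp [MonoidHom.mem_ker, hq]
  have hmap : (complement iA iB q).map φ.toMonoidHom = complement iA iB q := by
    apply le_antisymm
    · rw [Subgroup.map_le_iff_le_comap, complement, Subgroup.closure_le, ← complement]
      rintro y (⟨b, hb⟩ | ⟨t, a, ht, hb⟩)
      · have e : y = ⟨iB b, hb ▸ y.2⟩ := Subtype.ext hb
        change φ y ∈ complement iA iB q
        rw [e, h1]
        exact mem_complement rfl
      · have e : y = ⟨iB t * iA a * (iB t)⁻¹, hmem t a⟩ := Subtype.ext hb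
        change φ y ∈ complement iA iB q
        exact conj_mem_complement ht (e ▸ h2 t a (hmem t a))
    · rw [complement, Subgroup.closure_le, ← complement]
      rintro y (⟨b, hb⟩ | ⟨t, a, ht, hb⟩)
      · have e : y = ⟨iB b, hb ▸ y.2⟩ := Subtype.ext hb
        exact ⟨y, mem_complement hb, by
          change φ y = y
          rw [e, h1]⟩
      · refine ⟨⟨_, hmem t ((if q (iB t) = x then τ else 1)⁻¹ a)⟩, conj_mem_complement ht rfl, ?_⟩
        refine Subtype.ext ((h2 _ _ (hmem _ _)).trans ?_)
        rw [MulAut.apply_inv_self, hb]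
  let σ : MulAut (complement iA iB q) :=
    (φ.subgroupMap (complement iA iB q)).trans (MulEquiv.subgroupCongr hmap)
  have hσ (y) : ((σ y : complement iA iB q) : q.ker) = φ y := rfl
  refine ⟨σ, Subtype.ext ?_, ⟨⟨iB (s x) * iA a * (iB (s x))⁻¹, hmem _ _⟩,
    conj_mem_complement (by simpa [hs]) rfl⟩, fun e => ha (hiA ?_)⟩
  · rw [hσ]
    exact h1 cB _
  · have e : (φ ⟨iB (s x) * iA a * (iB (s x))⁻¹, hmem _ _⟩ : G) = _ :=
      congrArg (fun y : complement iA iB q => ((y : q.ker) : G)) e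
    rw [h2] at e
    simpa [hs] using e

end Kernel

/-- The twist is found in the kernel of `G → ℤ/k` that kills `A`; `k ≠ 1` ensures that a nontrivial
conjugate of `A` is available for `τ`. -/
theorem hasTwist_of_dvd (h : IsCyclicAmalgam iA iB cA cB) (hiA : Function.Injective iA)
    {f : A →* Multiplicative ℤ} (hf : Function.Surjective f) (hfc : f cA = 1)
    (hτ : ∃ τ : MulAut A, τ cA = cA ∧ ∃ a, τ a ≠ a) (hB : ∀ x y : B, x * y = y * x)
    {g : B →* Multiplicative ℤ} (hg : Function.Surjective g) {k : ℕ} (hk0 : k ≠ 0) (hk1 : k ≠ 1)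
    (hgc : (k : ℤ) ∣ (g cB).toAdd) {p : ℕ} (hp : p.Prime) : HasTwist G p := by
  have : NeZero k := ⟨hk0⟩
  obtain ⟨u, hu⟩ := hg (Multiplicative.ofAdd 1)
  obtain ⟨q, s, hq, -, hs, hs1⟩ :=
    h.symm.exists_hom_zmod k g ((ZMod.intCast_zmod_eq_zero_iff_dvd _ _).2 hgc) hu
  have hQ : ∃ x : Multiplicative (ZMod k), x ≠ 1 := by
    have : Nontrivial (ZMod k) := ZMod.nontrivial_iff.2 hk1
    exact exists_ne 1
  refine HasTwist.of_injective q.ker.subtype Subtype.val_injective ?_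
    ((h.ker_isCyclicAmalgam hB hq s hs hs1).hasTwist Subtype.val_injective hf hfc
      (h.exists_mulAut_complement hiA hq s hs hs1 hQ hτ) hp)
  rw [Subgroup.range_subtype]
  infer_instance

end IsCyclicAmalgam

/-! ### From the pushout to the universal property, and the case distinction on `B` -/

/-- An amalgamated product over the cyclic subgroup generated by `c`. -/
theorem IsAmalgamatedProduct.isCyclicAmalgam {G : Type u} [Group G] {A B C : Subgroup G}
    (hG : IsAmalgamatedProduct A B C) {c : G} (hc : ∀ x ∈ C, x ∈ Subgroup.zpowers c)
    (hcA : c ∈ A) (hcB : c ∈ B) :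
    IsCyclicAmalgam A.subtype B.subtype ⟨c, hcA⟩ ⟨c, hcB⟩ := by
  obtain ⟨hA, hB, hbij⟩ := hG
  have hof (i : Bool) (x : amalgamFactor A B i) :
      amalgamHom hA hB (Monoid.PushoutI.of i x) = x :=
    Monoid.PushoutI.lift_of (fun i => (amalgamFactor A B i).subtype) C.subtype (fun _ => rfl) x
  have hle (i : Bool) : amalgamFactor A B i ≤ A ⊔ B := by
    cases i
    · exact le_sup_left
    · exact le_sup_right
  refine ⟨rfl, ?_, fun Y _ α β e => ?_⟩
  · rw [Subgroup.range_subtype, Subgroup.range_subtype]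
    refine top_le_iff.1 fun x _ => ?_
    obtain ⟨w, rfl⟩ := hbij.2 x
    induction w using Monoid.PushoutI.induction_on with
    | of i g =>
      rw [hof]
      exact hle i g.2
    | base c =>
      have : amalgamHom hA hB (Monoid.PushoutI.base _ c) = c :=
        Monoid.PushoutI.lift_base (fun i => (amalgamFactor A B i).subtype) C.subtype
          (fun _ => rfl) c
      exact this ▸ Subgroup.mem_sup_left (hA c.2)
    | mul x y hx hy =>
      rw [map_mul]
      exact mul_mem (hx trivial) (hy trivial)
  · let E := MulEquiv.ofBijective (amalgamHom hA hB) hbij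
    let F (i : Bool) : amalgamFactor A B i →* Y :=
      match i with
      | false => α
      | true => β
    have hF (i : Bool) : (F i).comp (Subgroup.inclusion (le_amalgamFactor hA hB i)) =
        α.comp (Subgroup.inclusion hA) := by
      cases i
      · rfl
      · refine MonoidHom.ext fun x => ?_
        obtain ⟨n, hn⟩ := hc x x.2
        have e1 : Subgroup.inclusion hB x = ⟨c, hcB⟩ ^ n := Subtype.ext hn.symm
        have e2 : Subgroup.inclusion hA x = ⟨c, hcA⟩ ^ n := Subtype.ext hn.symm
        change β (Subgroup.inclusion hB x) = α (Subgroup.inclusion hA x)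
        rw [e1, e2, map_zpow, map_zpow, e]
    let γ : G →* Y := (Monoid.PushoutI.lift F _ hF).comp E.symm.toMonoidHom
    have hγ (i : Bool) (x : amalgamFactor A B i) : γ x = F i x := by
      have : E.symm (x : G) = Monoid.PushoutI.of i x := by
        rw [MulEquiv.symm_apply_eq]
        exact (hof i x).symm
      change Monoid.PushoutI.lift F _ hF (E.symm (x : G)) = _
      rw [this, Monoid.PushoutI.lift_of]
    exact ⟨γ, hγ false, hγ true⟩

theorem mainTheorem8 {G : Type*} [Group G] (A B C : Subgroup G)
    (hG : IsAmalgamatedProduct A B C)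
    (hC_cyclic : IsCyclic C) (hC_infinite : Infinite C)
    (hCA : C ≠ A) (hCB : C ≠ B)
    (hroot : HasUniqueRoots G)
    (hA : MapsOntoInt (A ⧸ Subgroup.normalClosure ((C.subgroupOf A : Subgroup A) : Set A)))
    (hB : (∀ x ∈ B, ∀ y ∈ B, x * y = y * x) → MapsOntoInt B) :
    ¬ Group.FG (AbstractCommensurator G) := by
  obtain ⟨⟨c, hcC⟩, hc⟩ := hC_cyclic.exists_generator
  have hc (x : G) (hx : x ∈ C) : x ∈ Subgroup.zpowers c := by
    obtain ⟨n, hn⟩ := hc ⟨x, hx⟩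
    exact ⟨n, congrArg Subtype.val hn⟩
  have hc1 : c ≠ 1 := by
    rintro rfl
    have : Subsingleton C := ⟨fun x y => Subtype.ext <| by
      rw [Subgroup.zpowers_one_eq_bot] at hc
      rw [Subgroup.mem_bot.1 (hc x x.2), Subgroup.mem_bot.1 (hc y y.2)]⟩
    exact not_finite C
  have hcA : c ∈ A := hG.1 hcC
  have hcB : c ∈ B := hG.2.1 hcC
  have h := hG.isCyclicAmalgam hc hcA hcB
  obtain ⟨f', hf'⟩ := hA
  let f : A →* Multiplicative ℤ := f'.comp (QuotientGroup.mk' _)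
  have hf : Function.Surjective f := hf'.comp (QuotientGroup.mk'_surjective _)
  have hfc : f ⟨c, hcA⟩ = 1 := by
    have : (QuotientGroup.mk' (Subgroup.normalClosure ((C.subgroupOf A : Subgroup A) : Set A)))
        ⟨c, hcA⟩ = 1 :=
      (QuotientGroup.eq_one_iff _).2 (Subgroup.subset_normalClosure hcC)
    rw [MonoidHom.comp_apply, this, map_one]
  refine AbstractCommensurator.not_fg_of_hasTwist hroot fun p hp => ?_
  by_cases hcomm : ∀ x y : B, x * y = y * x
  · obtain ⟨g, hg⟩ := hB fun x hx y hy => congrArg Subtype.val (hcomm ⟨x, hx⟩ ⟨y, hy⟩)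
    by_cases h0 : (g ⟨c, hcB⟩).toAdd.natAbs = 0
    · exact h.hasTwist Subtype.val_injective hf hfc
        (exists_mulAut_of_map_eq_one (fun e => hc1 (congrArg Subtype.val e)) hg
          (Int.natAbs_eq_zero.1 h0)) hp
    by_cases h1 : (g ⟨c, hcB⟩).toAdd.natAbs = 1
    · refine h.hasTwist Subtype.val_injective hf hfc
        (exists_mulAut_of_isUnit hcomm ?_ ?_ (f := g) ?_) hp
      · exact fun x y n hn e =>
          Subtype.ext (hroot x y n hn (congrArg Subtype.val e))
      -- If `c` generated `B`, then `C = B`.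
      · by_contra! hall
        refine hCB (le_antisymm hG.2.1 fun b hb => ?_)
        obtain ⟨n, hn⟩ := hall ⟨b, hb⟩
        have : c ^ n = b := congrArg Subtype.val hn
        exact this ▸ zpow_mem hcC n
      · rw [← Int.natAbs_mul_self' , h1]
        rfl
    · exact h.hasTwist_of_dvd Subtype.val_injective hf hfc
        (exists_mulAut_of_map_eq_one (fun e => hc1 (congrArg Subtype.val e)) hf hfc) hcomm hg h0 h1
          (Int.natAbs_dvd.2 dvd_rfl) hp
  · exact h.hasTwist Subtype.val_injective hf hfc (exists_mulAut_of_not_comm _ hcomm) hp
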